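/- Let $m\ge 2$ and let $\mathcal A=(a_{i_1i_2\cdots i_m})$, $i_1,\dots,i_m\in N=\{1,\dots,n\}$, be a complex tensor of order $m$ and dimension $n$. For $i\in N$ put $$r_i(\mathcal A)=\sum_{\substack{i_2,\dots,i_m\in N\\ (i_2,\dots,i_m)\ne(i,\dots,i)}}|a_{ii_2\cdots i_m}| .$$ The determinant $\det(\mathcal A)$ is the resultant of the ordered system of $n$ homogeneous polynomials of degree $m-1$ in $x_1,\dots,x_n$ $$(\mathcal A x^{m-1})_i=\sum_{i_2,\dots,i_m\in N}a_{ii_2\cdots i_m}x_{i_2}\cdots x_{i_m},\qquad i\in N .$$ Here the resultant of $n$ forms of degree $d\ge 1$ in $n$ variables is the value, at the coefficients of the forms, of the generic resultant: with $F_1,\dots,F_n$ the generic forms of degree $d$, whose coefficients are indeterminates $u$, it is the unique polynomial in $\mathbb Z[u]$ that generates the ideal $\{r\in\mathbb Z[u] : x_k^{M}r\in(F_1,\dots,F_n)\subseteq\mathbb Z[u][x]\text{ for all }k\text{ and some }M\}$ and takes the value $1$ at the system $x_1^d,\dots,x_n^d$. Suppose that for each $i\in N$, either $$|a_{i\cdots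 i}|>r_i(\mathcal A)$$ or $$|a_{j\cdots j}|<2|a_{ji\cdots i}|-r_j(\mathcal A)\quad\text{for some } j\in N,\ j\ne i .$$ Then $\det(\mathcal A)\ne 0$. -/

import Mathlib

open MvPolynomial

noncomputable section

namespace TensorDet

/-- Tensors of order `m` and dimension `n` with entries in `K`. -/
abbrev Tensor (K : Type*) (m n : ℕ) : Type _ := (Fin m → Fin n) → K

/-! ### The resultant of `n` forms of degree `d` in `n` variables -/

/-- The exponent vectors of the monomials of degree `d` in `n` variables. -/
abbrev Expo (n d : ℕ) : Type :=
  {α : Fin n →₀ ℕ // α ∈ (Finset.univ : Finset (Fin n)).finsuppAntidiag d}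

/-- The ring `ℤ[u]`, with one indeterminate `u_{i,α}` for each form `i` and each monomial `x^α` of
degree `d`. -/
abbrev CoeffRing (n d : ℕ) : Type := MvPolynomial (Fin n × Expo n d) ℤ

/-- The generic form `F_i = ∑_{|α| = d} u_{i,α} x^α`. -/
def genericForm (n d : ℕ) (i : Fin n) : MvPolynomial (Fin n) (CoeffRing n d) :=
  ∑ α : Expo n d, monomial α.1 (X (i, α))

/-- The ideal of `ℤ[u][x]` generated by the generic forms `F_1, …, F_n`. -/
def genericIdeal (n d : ℕ) : Ideal (MvPolynomial (Fin n) (CoeffRing n d)) :=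
  Ideal.span (Set.range (genericForm n d))

/-- The ideal of inertia forms of degree `0` (the elimination ideal, or resultant ideal) in `ℤ[u]`:
those `r ∈ ℤ[u]` such that, for some `N`, all the products `x_k ^ N * r` lie in
`(F_1, …, F_n)`. -/
def inertiaIdeal (n d : ℕ) : Ideal (CoeffRing n d) where
  carrier := {r | ∃ N : ℕ, ∀ k : Fin n, X k ^ N * C r ∈ genericIdeal n d}
  zero_mem' := ⟨0, fun k => by simp⟩
  add_mem' := by
    rintro r s ⟨N, hN⟩ ⟨M, hM⟩
    refine ⟨N + M, fun k => ?_⟩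
    have h : (X k ^ (N + M) * C (r + s) : MvPolynomial (Fin n) (CoeffRing n d)) =
        X k ^ M * (X k ^ N * C r) + X k ^ N * (X k ^ M * C s) := by
      rw [C_add]; ring
    rw [h]
    exact add_mem (Ideal.mul_mem_left _ _ (hN k)) (Ideal.mul_mem_left _ _ (hM k))
  smul_mem' := by
    rintro c r ⟨N, hN⟩
    refine ⟨N, fun k => ?_⟩
    have h : (X k ^ N * C (c • r) : MvPolynomial (Fin n) (CoeffRing n d)) =
        C c * (X k ^ N * C r) := by
      rw [smul_eq_mul, C_mul]; ring
    rw [h]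
    exact Ideal.mul_mem_left _ _ (hN k)

/-- The coefficients of the system of forms `x_1^d, …, x_n^d`. -/
def purePowers (n d : ℕ) : Fin n × Expo n d → ℤ :=
  fun p => if p.2.1 = Finsupp.single p.1 d then 1 else 0

/-- `R ∈ ℤ[u]` is the generic resultant of `n` forms of degree `d` in `n` variables: it generates
the ideal of inertia forms, and it takes the value `1` at the system `x_1^d, …, x_n^d`. -/
def IsGenericResultant (n d : ℕ) (R : CoeffRing n d) : Prop :=
  inertiaIdeal n d = Ideal.span {R} ∧ eval (purePowers n d) R = 1

/-- There is at most one generic resultant. -/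
theorem IsGenericResultant.unique {n d : ℕ} {R S : CoeffRing n d}
    (hR : IsGenericResultant n d R) (hS : IsGenericResultant n d S) : R = S := by
  have h : Associated R S := Ideal.span_singleton_eq_span_singleton.1 (hR.1.symm.trans hS.1)
  obtain ⟨u, rfl⟩ := h
  obtain ⟨z, -, hz⟩ := MvPolynomial.isUnit_iff_eq_C_of_isReduced.1 u.isUnit
  have h1 := hS.2
  rw [hz, map_mul, hR.2, eval_C, one_mul] at h1
  rw [hz, h1, C_1, mul_one]

open Classical in
/-- The generic resultant (with the value `0` should there be none). -/
def genericResultant (n d : ℕ) : CoeffRing n d :=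
  if h : ∃ R, IsGenericResultant n d R then h.choose else 0

/-- The resultant of the forms `f_1, …, f_n` of degree `d` in `n` variables: the generic resultant,
evaluated at the coefficients of the forms. -/
def resultant {K : Type*} [CommRing K] {n : ℕ} (d : ℕ) (f : Fin n → MvPolynomial (Fin n) K) : K :=
  aeval (fun p : Fin n × Expo n d => coeff p.2.1 (f p.1)) (genericResultant n d)

/-! ### Tensors of order `m = d + 1` -/

/-- The `i`-th form of the system `A x^{m-1}`, of degree `d = m - 1`, namely
`∑ a_{i i_2 … i_m} x_{i_2} ⋯ x_{i_m}`. -/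
def tensorForm {K : Type*} [CommRing K] {d n : ℕ} (A : Tensor K (d + 1) n) (i : Fin n) :
    MvPolynomial (Fin n) K :=
  ∑ α : Fin d → Fin n, C (A (Fin.cons i α)) * ∏ k, X (α k)

/-- The determinant of a tensor: the resultant of the system `A x^{m-1} = 0`. -/
def det {K : Type*} [CommRing K] {d n : ℕ} (A : Tensor K (d + 1) n) : K :=
  resultant d (tensorForm A)

/-- `r_i(A)`: the sum of the `|a_{i i_2 … i_m}|` over all `(i_2, …, i_m) ≠ (i, …, i)`. -/
def offDiagSum {d n : ℕ} (A : Tensor ℂ (d + 1) n) (i : Fin n) : ℝ :=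
  ∑ α : Fin d → Fin n with α ≠ fun _ => i, ‖A (Fin.cons i α)‖

end TensorDet

end

/-! Suppose `x ≠ 0` solves the system, and let `|x_i|` be maximal. Isolating the term `a_{ji⋯i}
x_i^d` in equation `j` and dividing by `|x_i|^d` bounds `|a_{ji⋯i}|` by the sum of the other moduli
in row `j`. For `j = i` this contradicts the first alternative. In general it reads `2|a_{ji⋯i}| ≤
|a_{j⋯j}| + r_j`, which contradicts the second. So the only common zero is `0`
(`eq_zero_of_dominant`).

The rest shows that the resultant, defined through inertia forms, exists and is nonzero at systems
with only the trivial zero. Existence: the ideal of inertia forms is prime and contains no nonzero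
polynomial free of one chosen coefficient, hence is principal by Gauss's lemma. Its generator takes
a value at `x_1^d, …, x_n^d` that no prime divides, so a sign normalizes it.

Nonvanishing: by the Nullstellensatz the forms generate powers of all the variables, so some
Macaulay matrix has full column rank at the system. Its maximal minors are inertia forms by Cramer's
rule, hence multiples of the resultant, and one of them does not vanish there. -/

noncomputable section

/-! ### Principal prime ideals in polynomial rings -/

/-- A prime ideal of `A[X]`, for `A` a unique factorization domain, which meets `A` only in zero is
principal. -/
theorem Polynomial.isPrincipal_of_isPrime_of_comap_C {A : Type*} [CommRing A] [IsDomain A]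
    [UniqueFactorizationMonoid A] {P : Ideal (Polynomial A)} (hP : P.IsPrime)
    (h0 : ∀ a : A, Polynomial.C a ∈ P → a = 0) : ∃ R, P = Ideal.span {R} := by
  classical
  let _ : NormalizedGCDMonoid A := Nonempty.some inferInstance
  by_cases hbot : P = ⊥
  · exact ⟨0, by simp [hbot]⟩
  obtain ⟨R, hRP, hR⟩ := hP.exists_mem_prime_of_ne_bot hbot
  refine ⟨R, le_antisymm (fun g hg => ?_) ((Ideal.span_singleton_le_iff_mem _).2 hRP)⟩
  rw [Ideal.mem_span_singleton]
  by_contra hRg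
  let K := FractionRing A
  have hinj : Function.Injective (algebraMap A K) := IsFractionRing.injective A K
  have hdeg : R.natDegree ≠ 0 := by
    intro h
    rw [Polynomial.eq_C_of_natDegree_eq_zero h] at hRP
    have := h0 _ hRP
    apply hR.ne_zero
    rw [Polynomial.eq_C_of_natDegree_eq_zero h, this, Polynomial.C_0]
  have hprim : R.IsPrimitive := hR.irreducible.isPrimitive hdeg
  have hirr : Irreducible (R.map (algebraMap A K)) :=
    (hprim.irreducible_iff_irreducible_map_fraction_map).1 hR.irreducible
  have hnd : ¬ R.map (algebraMap A K) ∣ g.map (algebraMap A K) := fun h =>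
    hRg (hprim.dvd_of_fraction_map_dvd_fraction_map (K := K) h)
  -- A Bézout identity over the fraction field; clearing its denominators `s`, `t` puts the nonzero
  -- constant `s * t` into `P`.
  obtain ⟨a, b, hab⟩ := (hirr.coprime_iff_not_dvd).2 hnd
  obtain ⟨s, hs0, hs⟩ := IsLocalization.integerNormalization_spec (nonZeroDivisors A) a
  obtain ⟨t, ht0, ht⟩ := IsLocalization.integerNormalization_spec (nonZeroDivisors A) b
  set a' := IsLocalization.integerNormalization (nonZeroDivisors A) a
  set b' := IsLocalization.integerNormalization (nonZeroDivisors A) b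
  have key : Polynomial.C (s * t) =
      Polynomial.C t * a' * R + Polynomial.C s * b' * g := by
    apply Polynomial.map_injective _ hinj
    simp only [Polynomial.map_add, Polynomial.map_mul, Polynomial.map_C, hs, ht, map_mul,
      Algebra.smul_def]
    simp only [Polynomial.algebraMap_apply, IsScalarTower.algebraMap_apply A K (Polynomial K)]
    linear_combination (-Polynomial.C (algebraMap A K s) * Polynomial.C (algebraMap A K t)) * hab
  have hmem : Polynomial.C (s * t) ∈ P := by
    rw [key]
    exact add_mem (P.mul_mem_left _ hRP) (P.mul_mem_left _ hg)
  exact mul_ne_zero (nonZeroDivisors.ne_zero hs0) (nonZeroDivisors.ne_zero ht0) (h0 _ hmem)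

/-- A prime ideal of `ℤ[u]` which contains no nonzero polynomial free of a given variable is
principal. -/
theorem MvPolynomial.isPrincipal_of_isPrime_of_free {σ : Type*} (p₀ : σ)
    {P : Ideal (MvPolynomial σ ℤ)} (hP : P.IsPrime)
    (h0 : ∀ s : MvPolynomial {p : σ // p ≠ p₀} ℤ, rename Subtype.val s ∈ P → s = 0) :
    ∃ R, P = Ideal.span {R} := by
  classical
  let e : MvPolynomial σ ℤ ≃+* Polynomial (MvPolynomial {p : σ // p ≠ p₀} ℤ) :=
    ((renameEquiv ℤ (Equiv.optionSubtypeNe p₀).symm).trans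
      (optionEquivLeft ℤ {p : σ // p ≠ p₀})).toRingEquiv
  have he : ∀ s : MvPolynomial {p : σ // p ≠ p₀} ℤ,
      e (rename Subtype.val s) = Polynomial.C s := by
    intro s
    induction s using MvPolynomial.induction_on with
    | C a => simp [e]
    | add p q hp hq => simp [hp, hq]
    | mul_X p i hp =>
      rw [map_mul, map_mul, hp, rename_X, map_mul]
      congr 1
      have : (Equiv.optionSubtypeNe p₀).symm i.1 = some i := by
        rw [Equiv.symm_apply_eq]; simp
      simp [e, this]
  have hQ : (P.comap e.symm.toRingHom).IsPrime := Ideal.IsPrime.comap _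
  obtain ⟨R, hR⟩ := Polynomial.isPrincipal_of_isPrime_of_comap_C hQ (fun a ha => by
    apply h0
    rw [Ideal.mem_comap, ← he] at ha
    simpa using ha)
  refine ⟨e.symm R, ?_⟩
  ext g
  have h1 : g ∈ P ↔ e g ∈ P.comap e.symm.toRingHom := by
    rw [Ideal.mem_comap]; simp
  rw [h1, hR, Ideal.mem_span_singleton, Ideal.mem_span_singleton]
  constructor
  · intro h; simpa using map_dvd e.symm h
  · intro h; simpa using map_dvd e h

namespace TensorDet

variable {n d : ℕ}

/-! ### Evaluation of polynomials in `ℤ[u][x]` -/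

/-- The value at `(u, x)` of a polynomial in `ℤ[u][x]`. -/
def evalAt {K : Type*} [CommRing K] (u : Fin n × Expo n d → K) (x : Fin n → K) :
    MvPolynomial (Fin n) (CoeffRing n d) →+* K :=
  eval₂Hom (aeval u).toRingHom x

@[simp] theorem evalAt_C {K : Type*} [CommRing K] (u : Fin n × Expo n d → K) (x : Fin n → K)
    (r : CoeffRing n d) : evalAt u x (C r) = aeval u r := by
  simp [evalAt]

@[simp] theorem evalAt_X {K : Type*} [CommRing K] (u : Fin n × Expo n d → K) (x : Fin n → K)
    (k : Fin n) : evalAt u x (X k) = x k := by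
  simp [evalAt]

theorem evalAt_genericForm {K : Type*} [CommRing K] (u : Fin n × Expo n d → K) (x : Fin n → K)
    (i : Fin n) :
    evalAt u x (genericForm n d i) = ∑ α : Expo n d, u (i, α) * ∏ k, x k ^ α.1 k := by
  simp [evalAt, genericForm, eval₂_monomial, Finsupp.prod_fintype]

/-- A polynomial in `ℤ[u][x]` which vanishes at all real points is zero. -/
theorem eq_zero_of_evalAt_eq_zero {q : MvPolynomial (Fin n) (CoeffRing n d)}
    (h : ∀ (u : Fin n × Expo n d → ℝ) (x : Fin n → ℝ), evalAt u x q = 0) : q = 0 := by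
  ext α : 1
  rw [coeff_zero]
  apply MvPolynomial.map_injective (Int.castRingHom ℝ) Int.cast_injective
  rw [map_zero]
  refine MvPolynomial.funext fun u => ?_
  have h1 : MvPolynomial.map (aeval u).toRingHom q = 0 := by
    refine MvPolynomial.funext fun x => ?_
    rw [map_zero, eval_map]
    exact h u x
  have h2 := congrArg (coeff α) h1
  rw [coeff_map, coeff_zero] at h2
  rw [map_zero, eval_map]
  simpa [aeval_def] using h2

/-- A polynomial in `ℤ[u][x]` which vanishes at all real points with `x` in the torus is zero. -/
theorem eq_zero_of_evalAt_torus {q : MvPolynomial (Fin n) (CoeffRing n d)}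
    (h : ∀ (u : Fin n × Expo n d → ℝ) (x : Fin n → ℝ), (∀ k, x k ≠ 0) → evalAt u x q = 0) :
    q = 0 := by
  -- The extra factor vanishes off the torus, so the product vanishes at every real point.
  have h1 : q * ∏ k, X k = 0 := by
    refine eq_zero_of_evalAt_eq_zero fun u x => ?_
    rw [map_mul, map_prod]
    by_cases hx : ∀ k, x k ≠ 0
    · rw [h u x hx, zero_mul]
    · push Not at hx
      obtain ⟨k, hk⟩ := hx
      rw [Finset.prod_eq_zero (Finset.mem_univ k) (by simpa using hk), mul_zero]
  refine (mul_eq_zero.1 h1).resolve_right (Finset.prod_ne_zero_iff.2 fun k _ => X_ne_zero k)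

/-! ### Elimination of the coefficients of `x_k ^ d` -/

/-- The exponent vector of `x_k ^ d`. -/
def pureExpo (n d : ℕ) (k : Fin n) : Expo n d :=
  ⟨Finsupp.single k d, by simp [Finsupp.single_apply]⟩

theorem prod_pow_pureExpo {K : Type*} [CommRing K] (x : Fin n → K) (k : Fin n) :
    ∏ l, x l ^ (pureExpo n d k).1 l = x k ^ d := by
  rw [Finset.prod_eq_single k]
  · simp [pureExpo]
  · intro l _ hl
    simp [pureExpo, hl.symm]
  · simp

/-- The polynomials in `ℤ[u][x]` which do not involve the coefficients of `x_k ^ d`. -/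
def eliminated (n d : ℕ) (k : Fin n) : Subring (MvPolynomial (Fin n) (CoeffRing n d)) :=
  Subring.closure (Set.range X ∪ {q | ∃ p : Fin n × Expo n d, p.2 ≠ pureExpo n d k ∧ q = C (X p)})

theorem X_mem_eliminated (k l : Fin n) : X l ∈ eliminated n d k :=
  Subring.subset_closure (Or.inl ⟨l, rfl⟩)

theorem C_X_mem_eliminated {k : Fin n} {p : Fin n × Expo n d} (hp : p.2 ≠ pureExpo n d k) :
    C (X p) ∈ eliminated n d k :=
  Subring.subset_closure (Or.inr ⟨p, hp, rfl⟩)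

theorem evalAt_congr {K : Type*} [CommRing K] {k : Fin n}
    {q : MvPolynomial (Fin n) (CoeffRing n d)} (hq : q ∈ eliminated n d k)
    {u v : Fin n × Expo n d → K} (x : Fin n → K)
    (huv : ∀ p, p.2 ≠ pureExpo n d k → u p = v p) : evalAt u x q = evalAt v x q := by
  induction hq using Subring.closure_induction with
  | mem q hq =>
    rcases hq with ⟨l, rfl⟩ | ⟨p, hp, rfl⟩
    · simp
    · simpa using huv p hp
  | zero => simp
  | one => simp
  | add a b _ _ ha hb => rw [map_add, map_add, ha, hb]
  | neg a _ ha => rw [map_neg, map_neg, ha]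
  | mul a b _ _ ha hb => rw [map_mul, map_mul, ha, hb]

theorem genericForm_mem (i : Fin n) : genericForm n d i ∈ genericIdeal n d :=
  Ideal.subset_span ⟨i, rfl⟩

theorem genericForm_eq (i k : Fin n) :
    genericForm n d i = X k ^ d * C (X (i, pureExpo n d k)) +
      ∑ α ∈ Finset.univ.erase (pureExpo n d k), C (X (i, α)) * ∏ l, X l ^ α.1 l := by
  have h : ∀ α : Expo n d, (monomial α.1 (X (i, α)) : MvPolynomial (Fin n) (CoeffRing n d)) =
      C (X (i, α)) * ∏ l, X l ^ α.1 l := by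
    intro α
    rw [monomial_eq, Finsupp.prod_fintype _ _ (by simp)]
  rw [genericForm, ← Finset.add_sum_erase _ _ (Finset.mem_univ (pureExpo n d k)), h,
    prod_pow_pureExpo, mul_comm]
  simp_rw [h]

/-- Modulo the generic forms and up to a power of `x_k`, every polynomial in `u` can be written
without the coefficients of `x_k ^ d`. -/
theorem exists_eliminated (k : Fin n) (r : CoeffRing n d) :
    ∃ N : ℕ, ∃ q ∈ eliminated n d k, X k ^ N * C r - q ∈ genericIdeal n d := by
  induction r using MvPolynomial.induction_on with
  | C a =>
    refine ⟨0, C (C a), ?_, by simp⟩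
    have : (C (C a) : MvPolynomial (Fin n) (CoeffRing n d)) = (a : ℤ) := by simp
    rw [this]
    exact intCast_mem _ a
  | add r s hr hs =>
    obtain ⟨N, q, hq, h⟩ := hr
    obtain ⟨M, q', hq', h'⟩ := hs
    refine ⟨N + M, X k ^ M * q + X k ^ N * q',
      add_mem (mul_mem (pow_mem (X_mem_eliminated k k) _) hq)
        (mul_mem (pow_mem (X_mem_eliminated k k) _) hq'), ?_⟩
    have e : (X k ^ (N + M) * C (r + s) - (X k ^ M * q + X k ^ N * q') :
        MvPolynomial (Fin n) (CoeffRing n d)) =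
        X k ^ M * (X k ^ N * C r - q) + X k ^ N * (X k ^ M * C s - q') := by
      rw [C_add]; ring
    rw [e]
    exact add_mem (Ideal.mul_mem_left _ _ h) (Ideal.mul_mem_left _ _ h')
  | mul_X r p hr =>
    obtain ⟨N, q, hq, h⟩ := hr
    by_cases hp : p.2 = pureExpo n d k
    · obtain ⟨i, α⟩ := p
      obtain rfl : α = pureExpo n d k := hp
      set s := ∑ α ∈ Finset.univ.erase (pureExpo n d k),
        (C (X (i, α)) * ∏ l, X l ^ α.1 l : MvPolynomial (Fin n) (CoeffRing n d)) with hs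
      have hsm : s ∈ eliminated n d k := by
        refine sum_mem fun α hα => mul_mem (C_X_mem_eliminated (Finset.ne_of_mem_erase hα)) ?_
        exact prod_mem fun l _ => pow_mem (X_mem_eliminated k l) _
      -- Since `F_i = x_k^d u_{i,k} + s`, with `u_{i,k}` the coefficient of `x_k^d`, multiplication
      -- by `x_k^d` trades `u_{i,k}` for `-s`.
      refine ⟨N + d, -(q * s), neg_mem (mul_mem hq hsm), ?_⟩
      have e : (X k ^ (N + d) * C (r * X (i, pureExpo n d k)) - -(q * s) :
          MvPolynomial (Fin n) (CoeffRing n d)) =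
          (X k ^ N * C r) * genericForm n d i - s * (X k ^ N * C r - q) := by
        rw [genericForm_eq i k, ← hs, C_mul]; ring
      rw [e]
      exact sub_mem (Ideal.mul_mem_left _ _ (genericForm_mem i)) (Ideal.mul_mem_left _ _ h)
    · refine ⟨N, q * C (X p), mul_mem hq (C_X_mem_eliminated hp), ?_⟩
      have e : (X k ^ N * C (r * X p) - q * C (X p) : MvPolynomial (Fin n) (CoeffRing n d)) =
          C (X p) * (X k ^ N * C r - q) := by
        rw [C_mul]; ring
      rw [e]
      exact Ideal.mul_mem_left _ _ h

theorem evalAt_eq_zero_of_mem {K : Type*} [CommRing K] {u : Fin n × Expo n d → K} {x : Fin n → K}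
    (hux : ∀ i, evalAt u x (genericForm n d i) = 0) {q : MvPolynomial (Fin n) (CoeffRing n d)}
    (hq : q ∈ genericIdeal n d) : evalAt u x q = 0 := by
  have : genericIdeal n d ≤ RingHom.ker (evalAt u x) := by
    rw [genericIdeal, Ideal.span_le]
    rintro _ ⟨i, rfl⟩
    exact hux i
  exact this hq

/-- An inertia form vanishes at every system with a nontrivial common zero. -/
theorem aeval_eq_zero_of_mem_inertiaIdeal {K : Type*} [CommRing K] [IsDomain K]
    {r : CoeffRing n d} (hr : r ∈ inertiaIdeal n d) {u : Fin n × Expo n d → K} {x : Fin n → K}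
    (hux : ∀ i, evalAt u x (genericForm n d i) = 0) {k : Fin n} (hk : x k ≠ 0) :
    aeval u r = 0 := by
  obtain ⟨N, hN⟩ := hr
  have := evalAt_eq_zero_of_mem hux (hN k)
  rw [map_mul, map_pow, evalAt_X, evalAt_C] at this
  exact (mul_eq_zero.1 this).resolve_left (pow_ne_zero _ hk)

/-! ### Inertia forms as a vanishing ideal, and primality -/

/-- The systems of real forms with a common zero in the torus. -/
def torusSystems (n d : ℕ) : Set (Fin n × Expo n d → ℝ) :=
  {u | ∃ x : Fin n → ℝ, (∀ k, x k ≠ 0) ∧ ∀ i, evalAt u x (genericForm n d i) = 0}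

/-- Since `x_k ≠ 0`, each equation can be solved for its coefficient of `x_k^d`. Equations that
already hold are left unchanged. -/
theorem exists_torusSystem (k : Fin n) (u : Fin n × Expo n d → ℝ) (x : Fin n → ℝ) (hk : x k ≠ 0) :
    ∃ v : Fin n × Expo n d → ℝ, (∀ p, p.2 ≠ pureExpo n d k → v p = u p) ∧
      (∀ i, evalAt u x (genericForm n d i) = 0 → v (i, pureExpo n d k) = u (i, pureExpo n d k)) ∧
      ∀ i, evalAt v x (genericForm n d i) = 0 := by
  classical
  refine ⟨fun p => if p.2 = pureExpo n d k then
    u p - evalAt u x (genericForm n d p.1) / x k ^ d else u p, fun p hp => if_neg hp,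
    fun i hi => by simp [hi], fun i => ?_⟩
  have hd : x k ^ d ≠ 0 := pow_ne_zero _ hk
  have h : evalAt u x (genericForm n d i) = x k ^ d * u (i, pureExpo n d k) +
      ∑ α ∈ Finset.univ.erase (pureExpo n d k), u (i, α) * ∏ l, x l ^ α.1 l := by
    rw [genericForm_eq i k]; simp
  have h2 : ∑ α ∈ Finset.univ.erase (pureExpo n d k), (if α = pureExpo n d k then
      u (i, α) - evalAt u x (genericForm n d i) / x k ^ d else u (i, α)) * ∏ l, x l ^ α.1 l =
      ∑ α ∈ Finset.univ.erase (pureExpo n d k), u (i, α) * ∏ l, x l ^ α.1 l :=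
    Finset.sum_congr rfl fun α hα => by rw [if_neg (Finset.ne_of_mem_erase hα)]
  rw [genericForm_eq i k]
  simp only [map_add, map_mul, map_pow, map_sum, map_prod, evalAt_X, evalAt_C, aeval_X, h2, if_true]
  field_simp
  rw [h]; ring

/-- An eliminated polynomial congruent to `x_k ^ N r` vanishes if `r` vanishes on `torusSystems`. -/
theorem eliminated_eq_zero {k : Fin n} {q : MvPolynomial (Fin n) (CoeffRing n d)}
    (hq : q ∈ eliminated n d k) {r : CoeffRing n d} {N : ℕ}
    (h : X k ^ N * C r - q ∈ genericIdeal n d) (hr : ∀ u ∈ torusSystems n d, aeval u r = 0) :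
    q = 0 := by
  refine eq_zero_of_evalAt_torus fun u x hx => ?_
  obtain ⟨v, hv, -, hvx⟩ := exists_torusSystem k u x (hx k)
  have h1 := evalAt_eq_zero_of_mem hvx h
  rw [map_sub, map_mul, evalAt_C, hr v ⟨x, hx, hvx⟩, mul_zero, zero_sub, neg_eq_zero] at h1
  rw [← h1]
  exact evalAt_congr hq x fun p hp => (hv p hp).symm

/-- The inertia forms are the polynomials which vanish at the systems of real forms with a common
zero in the torus. -/
theorem mem_inertiaIdeal_iff (hn : 0 < n) (r : CoeffRing n d) :
    r ∈ inertiaIdeal n d ↔ ∀ u ∈ torusSystems n d, aeval u r = 0 := by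
  refine ⟨fun hr u ⟨x, hx, hux⟩ =>
    aeval_eq_zero_of_mem_inertiaIdeal hr hux (hx ⟨0, hn⟩), fun hr => ?_⟩
  have h : ∀ k, ∃ N : ℕ, X k ^ N * C r ∈ genericIdeal n d := by
    intro k
    obtain ⟨N, q, hq, h⟩ := exists_eliminated k r
    rw [eliminated_eq_zero hq h hr, sub_zero] at h
    exact ⟨N, h⟩
  choose N hN using h
  refine ⟨∑ k, N k, fun k => ?_⟩
  rw [← Finset.add_sum_erase _ _ (Finset.mem_univ k), pow_add, mul_right_comm]
  exact Ideal.mul_mem_right _ _ (hN k)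

/-- Eliminating the coefficients of `x_k^d` is multiplicative modulo the generic forms, and for an
inertia form the eliminated polynomial is zero. Primality then comes from `ℤ[u][x]` being a domain.
-/
theorem inertiaIdeal_isPrime (hn : 0 < n) (hne : inertiaIdeal n d ≠ ⊤) :
    (inertiaIdeal n d).IsPrime := by
  refine ⟨hne, fun {r s} hrs => ?_⟩
  simp only [mem_inertiaIdeal_iff hn] at hrs ⊢
  let k : Fin n := ⟨0, hn⟩
  obtain ⟨N, q, hq, h⟩ := exists_eliminated k r
  obtain ⟨M, q', hq', h'⟩ := exists_eliminated k s
  have h2 : X k ^ (N + M) * C (r * s) - q * q' ∈ genericIdeal n d := by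
    have e : (X k ^ (N + M) * C (r * s) - q * q' : MvPolynomial (Fin n) (CoeffRing n d)) =
        X k ^ M * C s * (X k ^ N * C r - q) + q * (X k ^ M * C s - q') := by
      rw [C_mul]; ring
    rw [e]
    exact add_mem (Ideal.mul_mem_left _ _ h) (Ideal.mul_mem_left _ _ h')
  -- One index `k` suffices here, because all coordinates of a torus point are nonzero.
  have aux : ∀ {r : CoeffRing n d} {N : ℕ}, X k ^ N * C r ∈ genericIdeal n d →
      ∀ u ∈ torusSystems n d, aeval u r = 0 := by
    rintro r N h u ⟨x, hx, hux⟩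
    have := evalAt_eq_zero_of_mem hux h
    rw [map_mul, map_pow, evalAt_X, evalAt_C] at this
    exact (mul_eq_zero.1 this).resolve_left (pow_ne_zero _ (hx k))
  rcases mul_eq_zero.1 (eliminated_eq_zero (mul_mem hq hq') h2 hrs) with h0 | h0
  · rw [h0, sub_zero] at h
    exact Or.inl (aux h)
  · rw [h0, sub_zero] at h'
    exact Or.inr (aux h')

/-! ### Inertia forms free of one coefficient -/

/-- An integer polynomial which vanishes on a neighbourhood of a real point is zero. -/
theorem eq_zero_of_eventually_aeval_eq_zero {σ : Type*} [Fintype σ] {r : MvPolynomial σ ℤ}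
    {u₀ : σ → ℝ} (h : ∀ᶠ u in nhds u₀, aeval u r = 0) : r = 0 := by
  obtain ⟨ε, hε, hball⟩ := Metric.eventually_nhds_iff_ball.1 h
  apply MvPolynomial.map_injective (Int.castRingHom ℝ) Int.cast_injective
  rw [map_zero]
  refine MvPolynomial.funext_set (fun i => Metric.ball (u₀ i) ε)
    (fun i => infinite_of_mem_nhds _ (Metric.ball_mem_nhds _ hε)) fun u hu => ?_
  rw [← ball_pi _ hε] at hu
  rw [map_zero, eval_map]
  simpa [aeval_def] using hball u hu

/-- The real systems `x_i ^ d - x_k ^ d`. -/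
def diffPowers (n d : ℕ) (k : Fin n) (p : Fin n × Expo n d) : ℝ :=
  (if p.2 = pureExpo n d p.1 then 1 else 0) - (if p.2 = pureExpo n d k then 1 else 0)

theorem evalAt_diffPowers (k i : Fin n) (x : Fin n → ℝ) :
    evalAt (diffPowers n d k) x (genericForm n d i) = x i ^ d - x k ^ d := by
  rw [evalAt_genericForm]
  simp only [diffPowers, sub_mul, Finset.sum_sub_distrib, ite_mul, one_mul, zero_mul,
    Finset.sum_ite_eq', Finset.mem_univ, if_true, prod_pow_pureExpo]

/-- The system of the equations `f_i = 0`, `i ≠ k`, and `x_k = 1`. -/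
def affineSystem (n d : ℕ) (k : Fin n) (z : (Fin n × Expo n d → ℝ) × (Fin n → ℝ)) : Fin n → ℝ :=
  fun i => if i = k then z.2 k - 1 else ∑ α : Expo n d, z.1 (i, α) * ∏ l, z.2 l ^ α.1 l

theorem contDiff_affineSystem (k : Fin n) : ContDiff ℝ 1 (affineSystem n d k) := by
  refine contDiff_pi.2 fun i => ?_
  unfold affineSystem
  split_ifs
  · fun_prop
  · fun_prop

/-- At `x = 1` the derivative in `x` sends `w` to `w_k` in place `k` and to `d (w_i - w_k)`
elsewhere, which is injective because `d ≠ 0`. -/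
theorem isInvertible_fderiv_affineSystem (hd : 1 ≤ d) (k : Fin n) :
    ((fderiv ℝ (affineSystem n d k) (diffPowers n d k, 1)).comp
      (ContinuousLinearMap.inr ℝ _ _)).IsInvertible := by
  set A := (fderiv ℝ (affineSystem n d k) (diffPowers n d k, 1)).comp
      (ContinuousLinearMap.inr ℝ (Fin n × Expo n d → ℝ) (Fin n → ℝ)) with hA
  have h1 : HasFDerivAt (fun x => affineSystem n d k (diffPowers n d k, x)) A 1 :=
    (((contDiff_affineSystem k).differentiable (by simp)) _).hasFDerivAt.comp 1
      (hasFDerivAt_prodMk_right _ _)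
  have h2 : ∀ w i, A w i = if i = k then w k else (d : ℝ) * w i - d * w k := by
    intro w i
    have h3 : HasFDerivAt (fun x => affineSystem n d k (diffPowers n d k, x) i)
      ((ContinuousLinearMap.proj i).comp A) 1 := (hasFDerivAt_pi'.1 h1) i
    by_cases hi : i = k
    · have h4 : HasFDerivAt (fun x => affineSystem n d k (diffPowers n d k, x) i)
          (ContinuousLinearMap.proj (R := ℝ) (φ := fun _ : Fin n => ℝ) k) 1 := by
        simp only [affineSystem, if_pos hi]
        exact (hasFDerivAt_apply k _).sub_const 1
      have := congrArg (fun f => f w) (h3.unique h4)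
      simpa [hi] using this
    · have h4 : HasFDerivAt (fun x => affineSystem n d k (diffPowers n d k, x) i)
          ((d : ℝ) • ContinuousLinearMap.proj (R := ℝ) (φ := fun _ : Fin n => ℝ) i -
            (d : ℝ) • ContinuousLinearMap.proj (R := ℝ) (φ := fun _ : Fin n => ℝ) k) 1 := by
        simp only [affineSystem, if_neg hi, ← evalAt_genericForm, evalAt_diffPowers]
        have h5 : ∀ j : Fin n, HasFDerivAt (fun x : Fin n → ℝ => x j ^ d)
            ((d : ℝ) • ContinuousLinearMap.proj (R := ℝ) (φ := fun _ : Fin n => ℝ) j) 1 := by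
          intro j
          have := (hasFDerivAt_apply (𝕜 := ℝ) (F' := fun _ : Fin n => ℝ) j 1).pow d
          simpa using this
        exact (h5 i).sub (h5 k)
      have := congrArg (fun f => f w) (h3.unique h4)
      simpa [hi] using this
  have hinj : Function.Injective A := by
    refine (injective_iff_map_eq_zero A).2 fun w hw => ?_
    have hk : w k = 0 := by simpa [h2] using congrFun hw k
    funext i
    by_cases hi : i = k
    · rw [hi, hk]; rfl
    · have hd0 : d ≠ 0 := by omega
      have h3 := congrFun hw i
      rw [h2, if_neg hi, hk, mul_zero, sub_zero] at h3
      simpa [hd0] using h3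
  refine ⟨(LinearEquiv.ofInjectiveEndo A.toLinearMap hinj).toContinuousLinearEquiv, ?_⟩
  ext w
  rfl

/-- No nonzero inertia form is free of the coefficient of `x_k ^ d` in the `k`-th form. -/
theorem eq_zero_of_rename_mem_inertiaIdeal (hd : 1 ≤ d) (k : Fin n)
    (s : MvPolynomial {p : Fin n × Expo n d // p ≠ (k, pureExpo n d k)} ℤ)
    (hs : rename Subtype.val s ∈ inertiaIdeal n d) : s = 0 := by
  apply rename_injective _ Subtype.val_injective
  rw [map_zero]
  rw [mem_inertiaIdeal_iff k.pos] at hs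
  -- By the implicit function theorem, for `u` near `diffPowers` the equations `i ≠ k` have a common
  -- zero near `1`, hence in the torus.
  have hstrict : HasStrictFDerivAt (affineSystem n d k)
      (fderiv ℝ (affineSystem n d k) (diffPowers n d k, 1)) (diffPowers n d k, 1) :=
    (contDiff_affineSystem k).contDiffAt.hasStrictFDerivAt (by simp)
  have hinv := isInvertible_fderiv_affineSystem hd k
  have h0 : affineSystem n d k (diffPowers n d k, 1) = 0 := by
    funext i
    by_cases hi : i = k
    · simp [affineSystem, hi]
    · simp only [affineSystem, if_neg hi, ← evalAt_genericForm, evalAt_diffPowers]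
      simp
  have hne : ∀ᶠ x in nhds (1 : Fin n → ℝ), ∀ l, x l ≠ 0 :=
    Filter.eventually_all.2 fun l =>
      ((continuous_apply l).continuousAt).eventually_ne (by simp)
  apply eq_zero_of_eventually_aeval_eq_zero (u₀ := diffPowers n d k)
  filter_upwards [hstrict.eventually_apply_implicitFunctionOfProdDomain hinv,
    (hstrict.tendsto_implicitFunctionOfProdDomain hinv).eventually hne] with u hu hx
  set x := hstrict.implicitFunctionOfProdDomain hinv u
  rw [h0] at hu
  -- Only equation `k` needs repair, and its coefficient of `x_k^d` is the one that `s` does not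
  -- involve.
  obtain ⟨v, hv, hv', hvx⟩ := exists_torusSystem k u x (hx k)
  have huv : ∀ p, p ≠ (k, pureExpo n d k) → v p = u p := by
    rintro ⟨i, α⟩ hp
    by_cases hα : α = pureExpo n d k
    · subst hα
      have hi : i ≠ k := fun h => hp (by rw [h])
      refine hv' i ?_
      have := congrFun hu i
      simp only [affineSystem, if_neg hi] at this
      rw [evalAt_genericForm, this, Pi.zero_apply]
    · exact hv _ hα
  have h1 := hs v ⟨x, hx, hvx⟩
  rw [aeval_rename] at h1 ⊢
  rw [← h1]
  congr 2
  funext p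
  exact (huv p.1 p.2).symm

/-! ### Macaulay matrices and their minors -/

/-- The system of forms with coefficients `u`. -/
def system {K : Type*} [CommRing K] (u : Fin n × Expo n d → K) (i : Fin n) :
    MvPolynomial (Fin n) K :=
  MvPolynomial.map (aeval u).toRingHom (genericForm n d i)

theorem mem_expo_iff {e : ℕ} (β : Fin n →₀ ℕ) :
    β ∈ (Finset.univ : Finset (Fin n)).finsuppAntidiag e ↔ β.degree = e := by
  simp [Finsupp.degree_eq_sum]

theorem isHomogeneous_system {K : Type*} [CommRing K] (u : Fin n × Expo n d → K) (i : Fin n) :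
    (system u i).IsHomogeneous d := by
  rw [system, genericForm, map_sum]
  refine IsHomogeneous.sum _ _ _ fun α _ => ?_
  rw [map_monomial]
  exact isHomogeneous_monomial _ ((mem_expo_iff _).1 α.2)

/-- The matrix of the coefficients of the products `x^γ F_i` with `|γ| = e`. -/
def macaulay (n d e : ℕ) : Matrix (Fin n × Expo n e) (Expo n (e + d)) (CoeffRing n d) :=
  fun c β => coeff β.1 (monomial c.2.1 1 * genericForm n d c.1)

theorem sum_macaulay {e : ℕ} (c : Fin n × Expo n e) :
    ∑ β, C (macaulay n d e c β) * monomial β.1 1 = monomial c.2.1 1 * genericForm n d c.1 := by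
  have hh : (monomial c.2.1 1 * genericForm n d c.1).IsHomogeneous (e + d) := by
    refine (isHomogeneous_monomial _ ((mem_expo_iff _).1 c.2.2)).mul ?_
    rw [genericForm]
    exact IsHomogeneous.sum _ _ _ fun α _ => isHomogeneous_monomial _ ((mem_expo_iff _).1 α.2)
  ext β : 1
  simp only [coeff_sum, coeff_C_mul, coeff_monomial, mul_ite, mul_one, mul_zero]
  by_cases hβ : β.degree = e + d
  · rw [Finset.sum_eq_single ⟨β, (mem_expo_iff _).2 hβ⟩]
    · simp [macaulay]
    · intro b _ hb
      exact if_neg fun h => hb (Subtype.ext h)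
    · simp
  · rw [hh.coeff_eq_zero hβ]
    refine Finset.sum_eq_zero fun b _ => if_neg fun h => hβ ?_
    rw [← h]
    exact (mem_expo_iff _).1 b.2

theorem map_macaulay {K : Type*} [CommRing K] (u : Fin n × Expo n d → K) {e : ℕ}
    (c : Fin n × Expo n e) (β : Expo n (e + d)) :
    aeval u (macaulay n d e c β) = coeff β.1 (monomial c.2.1 1 * system u c.1) := by
  have h : (monomial c.2.1 1 * system u c.1 : MvPolynomial (Fin n) K) =
      MvPolynomial.map (aeval u).toRingHom (monomial c.2.1 1 * genericForm n d c.1) := by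
    rw [map_mul, map_monomial, system, RingHom.map_one]
  rw [h, coeff_map]
  rfl

/-- The maximal minors of the Macaulay matrices are inertia forms. -/
theorem det_macaulay_mem_inertiaIdeal {e : ℕ} (a : Expo n (e + d) → Fin n × Expo n e) :
    ((macaulay n d e).submatrix a id).det ∈ inertiaIdeal n d := by
  set S := (macaulay n d e).submatrix a id with hS
  refine ⟨e + d, fun k => ?_⟩
  let β₀ := pureExpo n (e + d) k
  have hX : (X k ^ (e + d) : MvPolynomial (Fin n) (CoeffRing n d)) = monomial β₀.1 1 :=
    X_pow_eq_monomial
  -- Cramer's rule: row `β₀` of `adjugate S * S = det S • 1`, paired with the monomials of degree `e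
  -- + d`.
  have key : (X k ^ (e + d) * C S.det : MvPolynomial (Fin n) (CoeffRing n d)) =
      ∑ c, C (S.adjugate β₀ c) * (monomial (a c).2.1 1 * genericForm n d (a c).1) := by
    simp_rw [← sum_macaulay, Finset.mul_sum]
    rw [Finset.sum_comm]
    have h : ∀ β, ∑ c, C (S.adjugate β₀ c) * (C (macaulay n d e (a c) β) *
        (monomial β.1 1 : MvPolynomial (Fin n) (CoeffRing n d))) =
        C ((S.adjugate * S) β₀ β) * monomial β.1 1 := by
      intro β
      rw [Matrix.mul_apply, map_sum, Finset.sum_mul]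
      refine Finset.sum_congr rfl fun c _ => ?_
      rw [C_mul, mul_assoc]; rfl
    simp_rw [h, Matrix.adjugate_mul]
    rw [Finset.sum_eq_single β₀]
    · rw [Matrix.smul_apply, Matrix.one_apply_eq, smul_eq_mul, mul_one, hX, mul_comm]
    · intro β _ hβ
      rw [Matrix.smul_apply, Matrix.one_apply_ne hβ.symm, smul_zero, C_0, zero_mul]
    · simp
  rw [key]
  exact sum_mem fun c _ => Ideal.mul_mem_left _ _ (Ideal.mul_mem_left _ _ (genericForm_mem _))

/-- If the ideal of a system contains powers of all the variables, then the rows of some Macaulay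
matrix of the system span. -/
theorem span_macaulay_eq_top {K : Type*} [Field K] (hn : 0 < n) (u : Fin n × Expo n d → K)
    {N : ℕ} (hN : ∀ k, X k ^ N ∈ Ideal.span (Set.range (system u))) :
    Submodule.span K (Set.range ((macaulay n d (n * N)).map (aeval u))) = ⊤ := by
  -- Projection to the degree `n * N + d` part; multiples of `F_i` by monomials of degree other than
  -- `n * N` are killed.
  let π : MvPolynomial (Fin n) K →ₗ[K] (Expo n (n * N + d) → K) :=
    LinearMap.pi fun β => lcoeff K β.1
  have hπ : ∀ q β, π q β = coeff β.1 q := fun _ _ => rfl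
  set V := Submodule.span K (Set.range ((macaulay n d (n * N)).map (aeval u))) with hV
  have hmon : ∀ (i : Fin n) (γ : Fin n →₀ ℕ) (c : K), π (monomial γ c * system u i) ∈ V := by
    intro i γ c
    by_cases hγ : γ.degree = n * N
    · have : π (monomial γ c * system u i) =
          c • (macaulay n d (n * N)).map (aeval u) (i, ⟨γ, (mem_expo_iff _).2 hγ⟩) := by
        funext β
        rw [Pi.smul_apply, Matrix.map_apply, map_macaulay, hπ, ← coeff_smul, ← smul_mul_assoc,
          smul_monomial, smul_eq_mul, mul_one]
      rw [this]
      exact V.smul_mem _ (Submodule.subset_span ⟨_, rfl⟩)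
    · have : π (monomial γ c * system u i) = 0 := by
        funext β
        rw [hπ]
        refine ((isHomogeneous_monomial c (rfl : γ.degree = _)).mul
          (isHomogeneous_system u i)).coeff_eq_zero ?_
        rw [(mem_expo_iff _).1 β.2]
        omega
      rw [this]
      exact V.zero_mem
  have hideal : ∀ q ∈ Ideal.span (Set.range (system u)), π q ∈ V := by
    intro q hq
    obtain ⟨c, rfl⟩ := Ideal.mem_span_range_iff_exists_fun.1 hq
    rw [map_sum]
    refine sum_mem fun i _ => ?_
    rw [(c i).as_sum, Finset.sum_mul, map_sum]
    exact sum_mem fun γ _ => hmon i γ _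
  rw [eq_top_iff, ← (Pi.basisFun K (Expo n (n * N + d))).span_eq, Submodule.span_le]
  rintro _ ⟨β, rfl⟩
  -- Pigeonhole: if all `n` exponents were below `N`, the degree would be below `n * N`.
  have hβ : ∃ k, N ≤ β.1 k := by
    by_contra! h
    have h1 := (mem_expo_iff _).1 β.2
    rw [Finsupp.degree_eq_sum] at h1
    have h2 : ∑ k, β.1 k < ∑ _k : Fin n, N :=
      Finset.sum_lt_sum_of_nonempty ⟨⟨0, hn⟩, Finset.mem_univ _⟩ fun k _ => h k
    simp at h2
    omega
  obtain ⟨k, hk⟩ := hβ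
  have h1 : monomial β.1 (1 : K) ∈ Ideal.span (Set.range (system u)) := by
    have : monomial β.1 (1 : K) = monomial (β.1 - Finsupp.single k N) 1 * X k ^ N := by
      rw [X_pow_eq_monomial, monomial_mul, one_mul, tsub_add_cancel_of_le]
      simpa using hk
    rw [this]
    exact Ideal.mul_mem_left _ _ (hN k)
  have h2 : Pi.basisFun K (Expo n (n * N + d)) β = π (monomial β.1 1) := by
    funext b
    rw [hπ, coeff_monomial, Pi.basisFun_apply, Pi.single_apply]
    simp only [Subtype.ext_iff, eq_comm]
  rw [h2]
  exact hideal _ h1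

/-- If the ideal of a system contains powers of all the variables, then some inertia form does not
vanish at the system. -/
theorem exists_mem_inertiaIdeal_aeval_ne_zero {K : Type*} [Field K] (hn : 0 < n)
    (u : Fin n × Expo n d → K) {N : ℕ}
    (hN : ∀ k, X k ^ N ∈ Ideal.span (Set.range (system u))) :
    ∃ r ∈ inertiaIdeal n d, aeval u r ≠ 0 := by
  set M := (macaulay n d (n * N)).map (aeval u) with hM
  -- Independent rows with full span form a basis, so there are as many as columns and they give an
  -- invertible square minor.
  obtain ⟨κ, a, -, hspan, hli⟩ := exists_linearIndependent' K M
  rw [span_macaulay_eq_top hn u hN] at hspan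
  let b := Module.Basis.mk hli hspan.ge
  let e : Expo n (n * N + d) ≃ κ := (Pi.basisFun K (Expo n (n * N + d))).indexEquiv b
  refine ⟨_, det_macaulay_mem_inertiaIdeal (a ∘ e), ?_⟩
  have h : LinearIndependent K (M.submatrix (a ∘ e) id).row := hli.comp e e.injective
  have h2 := (Matrix.isUnit_iff_isUnit_det _).1 (Matrix.linearIndependent_rows_iff_isUnit.1 h)
  have h3 : aeval u ((macaulay n d (n * N)).submatrix (a ∘ e) id).det =
      (M.submatrix (a ∘ e) id).det := by
    rw [AlgHom.map_det]; rfl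
  rw [h3]
  exact h2.ne_zero

theorem system_eq {K : Type*} [CommRing K] (u : Fin n × Expo n d → K) (i : Fin n) :
    system u i = ∑ α : Expo n d, monomial α.1 (u (i, α)) := by
  rw [system, genericForm, map_sum]
  refine Finset.sum_congr rfl fun α _ => ?_
  rw [map_monomial]
  congr 1
  exact aeval_X u _

theorem system_purePowers (K : Type*) [CommRing K] (i : Fin n) :
    system (fun p => (purePowers n d p : K)) i = X i ^ d := by
  rw [system_eq, Finset.sum_eq_single (pureExpo n d i)]
  · simp [purePowers, pureExpo, X_pow_eq_monomial]
  · intro α _ hα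
    have : α.1 ≠ Finsupp.single i d := fun h => hα (Subtype.ext h)
    simp [purePowers, this]
  · simp

/-! ### Existence of the generic resultant -/

theorem inertiaIdeal_ne_top (hn : 0 < n) : inertiaIdeal n d ≠ ⊤ := by
  intro h
  have h1 : (1 : CoeffRing n d) ∈ inertiaIdeal n d := h ▸ Submodule.mem_top
  rw [mem_inertiaIdeal_iff hn] at h1
  -- The zero system vanishes at the torus point `(1, …, 1)`, but the constant `1` does not vanish
  -- at it.
  have := h1 0 ⟨1, by simp, fun i => by simp [evalAt_genericForm]⟩
  simp at this

theorem exists_isGenericResultant (hd : 1 ≤ d) : ∃ R, IsGenericResultant n d R := by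
  rcases Nat.eq_zero_or_pos n with rfl | hn
  · refine ⟨1, ?_, map_one _⟩
    rw [Ideal.span_singleton_one, Ideal.eq_top_iff_one]
    exact ⟨0, fun k => k.elim0⟩
  obtain ⟨R, hR⟩ := MvPolynomial.isPrincipal_of_isPrime_of_free
    ((⟨0, hn⟩, pureExpo n d ⟨0, hn⟩) : Fin n × Expo n d)
    (inertiaIdeal_isPrime hn (inertiaIdeal_ne_top hn))
    (eq_zero_of_rename_mem_inertiaIdeal hd ⟨0, hn⟩)
  have hunit : IsUnit (eval (purePowers n d) R) := by
    rw [Int.isUnit_iff_natAbs_eq, Nat.eq_one_iff_not_exists_prime_dvd]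
    intro p hp hdvd
    -- Over `ZMod p` the pure powers trivially generate powers of all the variables, so some
    -- multiple of `R` is nonzero there modulo `p`. This contradicts `p` dividing the value of `R`.
    have : Fact p.Prime := ⟨hp⟩
    obtain ⟨r, hr, hr0⟩ := exists_mem_inertiaIdeal_aeval_ne_zero (K := ZMod p) hn
      (fun q => (purePowers n d q : ZMod p)) (N := d) (fun k => by
        rw [← system_purePowers]
        exact Ideal.subset_span ⟨k, rfl⟩)
    rw [hR, Ideal.mem_span_singleton] at hr
    obtain ⟨s, rfl⟩ := hr
    rw [map_mul] at hr0
    apply left_ne_zero_of_mul hr0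
    have h1 : aeval (fun q => (purePowers n d q : ZMod p)) R =
        ((eval (purePowers n d) R : ℤ) : ZMod p) := by
      rw [← aeval_eq_eval]
      exact aeval_algebraMap_apply (R := ℤ) (ZMod p) (purePowers n d) R
    rw [h1, ZMod.intCast_zmod_eq_zero_iff_dvd]
    exact Int.natCast_dvd.2 hdvd
  rcases Int.isUnit_iff.1 hunit with h | h
  · exact ⟨R, hR, h⟩
  · exact ⟨-R, by rw [hR, Ideal.span_singleton_neg], by rw [map_neg, h]; rfl⟩

theorem isGenericResultant_genericResultant (hd : 1 ≤ d) :
    IsGenericResultant n d (genericResultant n d) := by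
  have h := exists_isGenericResultant (n := n) hd
  rw [genericResultant, dif_pos h]
  exact h.choose_spec

theorem system_coeff {K : Type*} [CommRing K] {f : Fin n → MvPolynomial (Fin n) K}
    (hf : ∀ i, (f i).IsHomogeneous d) (i : Fin n) :
    system (fun p : Fin n × Expo n d => coeff p.2.1 (f p.1)) i = f i := by
  rw [system_eq]
  ext β
  simp only [coeff_sum, coeff_monomial]
  by_cases hβ : β.degree = d
  · rw [Finset.sum_eq_single ⟨β, (mem_expo_iff _).2 hβ⟩]
    · simp
    · intro b _ hb
      exact if_neg fun h => hb (Subtype.ext h)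
    · simp
  · rw [(hf i).coeff_eq_zero hβ]
    refine Finset.sum_eq_zero fun b _ => if_neg fun h => hβ ?_
    rw [← h]
    exact (mem_expo_iff _).1 b.2

/-! ### Nonvanishing of the resultant -/

/-- The resultant of forms without a nontrivial common zero is not zero. -/
theorem resultant_ne_zero {K : Type*} [Field K] [IsAlgClosed K] (hd : 1 ≤ d)
    {f : Fin n → MvPolynomial (Fin n) K} (hf : ∀ i, (f i).IsHomogeneous d)
    (h : ∀ x : Fin n → K, (∀ i, eval x (f i) = 0) → x = 0) : resultant d f ≠ 0 := by
  have hR := isGenericResultant_genericResultant (n := n) hd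
  rcases Nat.eq_zero_or_pos n with rfl | hn
  · have h1 : genericResultant 0 d = C 1 := by
      rw [eq_C_of_isEmpty (genericResultant 0 d)]
      have := hR.2
      rw [eq_C_of_isEmpty (genericResultant 0 d), eval_C] at this
      rw [this]
    rw [resultant, h1]
    simp
  -- Nullstellensatz: each `X k` vanishes on the zero locus, which contains at most the origin.
  have hrad : ∀ k, ∃ N, X k ^ N ∈ Ideal.span (Set.range f) := by
    intro k
    change X k ∈ (Ideal.span (Set.range f)).radical
    rw [← vanishingIdeal_zeroLocus_eq_radical (k := K) (K := K), mem_vanishingIdeal_iff]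
    intro x hx
    rw [zeroLocus_span] at hx
    rw [h x fun i => by simpa [aeval_eq_eval] using hx (f i) ⟨i, rfl⟩]
    simp
  choose N hN using hrad
  have hsys : system (fun p : Fin n × Expo n d => coeff p.2.1 (f p.1)) = f :=
    funext (system_coeff hf)
  obtain ⟨r, hr, hr0⟩ := exists_mem_inertiaIdeal_aeval_ne_zero hn
    (fun p : Fin n × Expo n d => coeff p.2.1 (f p.1)) (N := ∑ k, N k) (fun k => by
      rw [hsys, ← Finset.add_sum_erase _ _ (Finset.mem_univ k), pow_add]
      exact Ideal.mul_mem_right _ _ (hN k))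
  rw [hR.1, Ideal.mem_span_singleton] at hr
  obtain ⟨s, rfl⟩ := hr
  rw [map_mul] at hr0
  exact left_ne_zero_of_mul hr0

/-! ### The dominance condition excludes nontrivial zeros -/

theorem isHomogeneous_tensorForm {K : Type*} [CommRing K] (A : Tensor K (d + 1) n) (i : Fin n) :
    (tensorForm A i).IsHomogeneous d := by
  refine IsHomogeneous.sum _ _ _ fun α _ => ?_
  have h : (∏ k, X (α k) : MvPolynomial (Fin n) K).IsHomogeneous (∑ _k : Fin d, 1) :=
    IsHomogeneous.prod _ _ _ fun k _ => isHomogeneous_X _ _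
  simpa using (isHomogeneous_C (Fin n) (A (Fin.cons i α))).mul h

theorem eval_tensorForm {K : Type*} [CommRing K] (A : Tensor K (d + 1) n) (i : Fin n)
    (x : Fin n → K) :
    eval x (tensorForm A i) = ∑ α : Fin d → Fin n, A (Fin.cons i α) * ∏ k, x (α k) := by
  simp [tensorForm]

/-- The modulus of a term of an equation `A x^{m-1} = 0` is at most the sum of the moduli of the
others. -/
theorem norm_term_le (A : Tensor ℂ (d + 1) n) {j : Fin n} {x : Fin n → ℂ}
    (hx : eval x (tensorForm A j) = 0) (β : Fin d → Fin n) {c : ℝ} (hc : ∀ k, ‖x k‖ ≤ c) :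
    ‖A (Fin.cons j β) * ∏ k, x (β k)‖ ≤
      (∑ α ∈ Finset.univ.erase β, ‖A (Fin.cons j α)‖) * c ^ d := by
  rw [eval_tensorForm, ← Finset.add_sum_erase _ _ (Finset.mem_univ β)] at hx
  rw [eq_neg_of_add_eq_zero_left hx, norm_neg, Finset.sum_mul]
  refine norm_sum_le_of_le _ fun α _ => ?_
  rw [norm_mul, norm_prod]
  refine mul_le_mul_of_nonneg_left ?_ (norm_nonneg _)
  calc ∏ k, ‖x (α k)‖ ≤ ∏ _k : Fin d, c :=
        Finset.prod_le_prod (fun _ _ => norm_nonneg _) fun k _ => hc _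
    _ = c ^ d := by simp

theorem offDiagSum_eq (A : Tensor ℂ (d + 1) n) (i : Fin n) :
    offDiagSum A i = ∑ α ∈ Finset.univ.erase fun _ => i, ‖A (Fin.cons i α)‖ := by
  rw [offDiagSum, Finset.filter_ne']

theorem cons_const (i : Fin n) : (Fin.cons i fun _ => i : Fin (d + 1) → Fin n) = fun _ => i := by
  funext k
  refine Fin.cases rfl (fun _ => rfl) k

theorem eq_zero_of_dominant (A : Tensor ℂ (d + 1) n)
    (hA : ∀ i : Fin n, ‖A (fun _ => i)‖ > offDiagSum A i ∨
      ∃ j : Fin n, j ≠ i ∧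
        ‖A (fun _ => j)‖ < 2 * ‖A (Fin.cons j fun _ => i)‖ - offDiagSum A j)
    (x : Fin n → ℂ) (hx : ∀ i, eval x (tensorForm A i) = 0) : x = 0 := by
  by_contra hne
  obtain ⟨l, hl⟩ := Function.ne_iff.1 hne
  obtain ⟨i, -, hi⟩ := Finset.exists_max_image Finset.univ (fun k => ‖x k‖) ⟨l, Finset.mem_univ l⟩
  have hc : ∀ k, ‖x k‖ ≤ ‖x i‖ := fun k => hi k (Finset.mem_univ k)
  have hpos : 0 < ‖x i‖ ^ d := pow_pos ((norm_pos_iff.2 hl).trans_le (hc l)) d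
  have key : ∀ j, ‖A (Fin.cons j fun _ => i)‖ ≤
      ∑ α ∈ Finset.univ.erase fun _ => i, ‖A (Fin.cons j α)‖ := by
    intro j
    have := norm_term_le A (hx j) (fun _ => i) hc
    simp only [Finset.prod_const, Finset.card_univ, Fintype.card_fin, norm_mul, norm_pow] at this
    exact le_of_mul_le_mul_right this hpos
  rcases hA i with h | ⟨j, hji, h⟩
  · have := key i
    rw [← offDiagSum_eq, cons_const] at this
    linarith
  · have h1 := key j
    have hmem : (fun _ => i) ∈ (Finset.univ : Finset (Fin d → Fin n)) := Finset.mem_univ _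
    have hmem' : (fun _ => j) ∈ (Finset.univ : Finset (Fin d → Fin n)) := Finset.mem_univ _
    -- The total of row `j` is split off once at `(i, …, i)` and once at `(j, …, j)`; comparison
    -- with `h1` gives `2|a_{ji⋯i}| ≤ |a_{j⋯j}| + r_j`.
    have h2 := Finset.add_sum_erase Finset.univ (fun α => ‖A (Fin.cons j α)‖) hmem
    have h3 := Finset.add_sum_erase Finset.univ (fun α => ‖A (Fin.cons j α)‖) hmem'
    rw [← offDiagSum_eq, cons_const] at h3
    linarith

end TensorDet

end

theorem mainTheorem3 (d n : ℕ) (hd : 1 ≤ d) (A : TensorDet.Tensor ℂ (d + 1) n)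
    (hA : ∀ i : Fin n,
      ‖A (fun _ => i)‖ > TensorDet.offDiagSum A i ∨
      ∃ j : Fin n, j ≠ i ∧
        ‖A (fun _ => j)‖ < 2 * ‖A (Fin.cons j fun _ => i)‖ - TensorDet.offDiagSum A j) :
    TensorDet.det A ≠ 0 :=
  TensorDet.resultant_ne_zero hd (TensorDet.isHomogeneous_tensorForm A)
    (TensorDet.eq_zero_of_dominant A hA)
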